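/- **Theorem (Main result).** Let $k\ge 2$ and $m\ge 1$, let $\gamma_1,\dots,\gamma_k\in\mathbb R^m$, and let $\mathcal D$ be a probability distribution on $\mathbb R^m$ that is supported on the closed unit ball and rotation invariant (i.e. invariant under all orthogonal transformations). In the $(\mathcal D,\gamma,n)$-stochastic ball model one draws independent vectors $r_{a,i}\sim\mathcal D$ ($1\le a\le k$, $1\le i\le n$) and takes the $N=kn$ points $x_{a,i}:=r_{a,i}+\gamma_a$; the $a$th planted cluster consists of $x_{a,1},\dots,x_{a,n}$. Let $D$ be the $N\times N$ matrix of squared distances, $D_{(a,i),(b,j)}=\|x_{a,i}-x_{b,j}\|_2^2$, and consider the $k$-means SDP relaxation $$\text{maximize } -\operatorname{Tr}(DX)\quad\text{subject to}\quad \operatorname{Tr}(X)=k,\quad X1=1,\quad X\ge 0 \text{ entrywise},\quad X\succeq 0,$$ over real symmetric $N\times N$ matrices $X$. We say that the SDP *recovers the planted clusters* if its unique solution is $X=\sum_{a=1}^k\frac1n 1_a1_a^\top$, where $1_a\in\{0,1\}^N$ is the indicator vector of the $a$th cluster. Put $$\Delta:=\min_{a\ne b}\|\gamma_a-\gamma_b\|,\qquad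 \operatorname{Cond}(\gamma):=\frac{\max_{a\neq b}\|\gamma_a-\gamma_b\|^2}{\min_{a\neq b}\|\gamma_a-\gamma_b\|^2}.$$ If $$\Delta>2+\frac{k^2}{m}\operatorname{Cond}(\gamma),$$ then the $k$-means SDP relaxation recovers the planted clusters in the $(\mathcal D,\gamma,n)$-stochastic ball model with probability $1-e^{-\Omega_{\mathcal D,\gamma}(n)}$; that is, there are $c>0$ and $n_0$, depending only on $\mathcal D$ and $\gamma$ (and thus on $m$, $k$), such that for every $n\ge n_0$ the probability of failure is at most $e^{-cn}$. -/

import Mathlib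

open MeasureTheory Filter

noncomputable section

namespace KMeansSDP

/-- The distribution `𝒟` is invariant under all orthogonal transformations of `ℝ^m`. -/
def RotationInvariant {m : ℕ} (𝒟 : Measure (EuclideanSpace ℝ (Fin m))) : Prop :=
  ∀ U : EuclideanSpace ℝ (Fin m) ≃ₗᵢ[ℝ] EuclideanSpace ℝ (Fin m), 𝒟.map U = 𝒟

/-- The distribution `𝒟` is supported on the (closed) unit ball of `ℝ^m`. -/
def SupportedOnUnitBall {m : ℕ} (𝒟 : Measure (EuclideanSpace ℝ (Fin m))) : Prop :=
  ∀ᵐ r ∂𝒟, ‖r‖ ≤ 1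

/-- The `(𝒟, γ, n)`-stochastic ball model: the joint law of the points
`x_{a,i} = r_{a,i} + γ_a`, where the `r_{a,i}` are independent with law `𝒟`. -/
def stochasticBallModel {m k : ℕ} (𝒟 : Measure (EuclideanSpace ℝ (Fin m))) [SigmaFinite 𝒟]
    (γ : Fin k → EuclideanSpace ℝ (Fin m)) (n : ℕ) :
    Measure (Fin k × Fin n → EuclideanSpace ℝ (Fin m)) :=
  (Measure.pi fun _ : Fin k × Fin n => 𝒟).map fun r p => r p + γ p.1

/-- The matrix of squared distances `‖x_i - x_j‖²`. -/
def sqDistMatrix {m : ℕ} {ι : Type*} (x : ι → EuclideanSpace ℝ (Fin m)) : Matrix ι ι ℝ :=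
  Matrix.of fun i j => ‖x i - x j‖ ^ 2

/-- The constraints of the `k`-means semidefinite program:
`Tr X = k`, `X 1 = 1`, `X ≥ 0` entrywise, and `X` is symmetric positive semidefinite. -/
structure IsFeasible {ι : Type*} [Fintype ι] (k : ℕ) (X : Matrix ι ι ℝ) : Prop where
  trace_eq : X.trace = k
  mulVec_one : X.mulVec 1 = 1
  nonneg : ∀ i j, 0 ≤ X i j
  posSemidef : X.PosSemidef

/-- `X` is a solution of the `k`-means SDP for the points `x`:
it maximizes `-Tr(D X)` over the feasible matrices, `D` being the matrix of squared distances. -/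
def IsSolution {m : ℕ} {ι : Type*} [Fintype ι] (k : ℕ) (x : ι → EuclideanSpace ℝ (Fin m))
    (X : Matrix ι ι ℝ) : Prop :=
  IsFeasible k X ∧
    ∀ Y : Matrix ι ι ℝ, IsFeasible k Y →
      -(sqDistMatrix x * Y).trace ≤ -(sqDistMatrix x * X).trace

/-- The indicator vector `1_a` of the `a`-th planted cluster. -/
def clusterIndicator {k : ℕ} (n : ℕ) (a : Fin k) : Fin k × Fin n → ℝ :=
  fun p => if p.1 = a then 1 else 0

/-- The matrix `∑_a (1/n) 1_a 1_aᵀ` that encodes the planted clusters. -/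
def plantedMatrix (k n : ℕ) : Matrix (Fin k × Fin n) (Fin k × Fin n) ℝ :=
  ∑ a : Fin k, (1 / (n : ℝ)) •
    Matrix.vecMulVec (clusterIndicator n a) (clusterIndicator n a)

/-- The `k`-means SDP recovers the planted clusters from the points `x`: its one and only
solution is the matrix of the planted clusters. -/
def RecoversPlanted {m k n : ℕ} (x : Fin k × Fin n → EuclideanSpace ℝ (Fin m)) : Prop :=
  ∀ X : Matrix (Fin k × Fin n) (Fin k × Fin n) ℝ, IsSolution k x X ↔ X = plantedMatrix k n

/-- The minimal separation `Δ = min_{a ≠ b} ‖γ_a - γ_b‖` of the centers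
(a minimum over a nonempty finite set as soon as `k ≥ 2`). -/
def minSeparation {m k : ℕ} (γ : Fin k → EuclideanSpace ℝ (Fin m)) : ℝ :=
  ⨅ p : {p : Fin k × Fin k // p.1 ≠ p.2}, ‖γ p.1.1 - γ p.1.2‖

/-- `Cond(γ)`: the ratio of the largest to the smallest squared distance between two centers
(a maximum and a minimum over a nonempty finite set as soon as `k ≥ 2`). -/
def condNumber {m k : ℕ} (γ : Fin k → EuclideanSpace ℝ (Fin m)) : ℝ :=
  (⨆ p : {p : Fin k × Fin k // p.1 ≠ p.2}, ‖γ p.1.1 - γ p.1.2‖ ^ 2) /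
    (⨅ p : {p : Fin k × Fin k // p.1 ≠ p.2}, ‖γ p.1.1 - γ p.1.2‖ ^ 2)

end KMeansSDP

end

/-! Optimality and uniqueness come from an explicit dual certificate. Write each point as `c a + y
(a, i)`, with `c a` the empirical mean of its cluster. For any `ζ` below all `‖c a - c b‖ ^ 2`, the
distance matrix splits as B + Q plus terms whose pairing with every feasible X is the same constant
(`IsFeasible.trace_sqDistMatrix_mul`). Here B is `dualSlack` and Q is `dualForm`; both pair to zero
with the planted matrix. If B is positive off the diagonal blocks and Q is positive semidefinite,
the planted matrix is optimal, and every optimum vanishes between clusters, which forces it to be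
planted (`recoversPlanted_of_certificate`).

Both conditions depend only on the separation of the means, the norms of the `y p`, and a bound `L`
on the cluster covariances (`dualForm_quadratic_nonneg`). Rotation invariance makes the covariance
of `𝒟` a multiple of the identity, at most 1/m. Hoeffding's inequality, applied to coordinates and
their pairwise products, puts the empirical moments near the true ones outside an exponentially rare
event. The condition number enters only through `1 ≤ condNumber γ`. -/

namespace KMeansSDP

open Finset RealInnerProductSpace

/-! ### Dual certificate for a deterministic point configuration. -/

section Deterministic

variable {m k n : ℕ}

/-- The slack matrix of the nonnegativity constraints in the dual certificate. -/
noncomputable def dualSlack (c : Fin k → EuclideanSpace ℝ (Fin m))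
    (y : Fin k × Fin n → EuclideanSpace ℝ (Fin m)) (ζ : ℝ) (p q : Fin k × Fin n) : ℝ :=
  if p.1 = q.1 then 0 else
    (‖c p.1 - c q.1‖ ^ 2 - ζ + 2 * ⟪c p.1 - c q.1, y p⟫) *
      (‖c p.1 - c q.1‖ ^ 2 - ζ - 2 * ⟪c p.1 - c q.1, y q⟫) / (‖c p.1 - c q.1‖ ^ 2 - ζ)

/-- The positive semidefinite matrix of the dual certificate. -/
noncomputable def dualForm (c : Fin k → EuclideanSpace ℝ (Fin m))
    (y : Fin k × Fin n → EuclideanSpace ℝ (Fin m)) (ζ : ℝ) (p q : Fin k × Fin n) : ℝ :=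
  n * ζ * (if p = q then 1 else 0) - ζ * (if p.1 = q.1 then 1 else 0) - 2 * ⟪y p, y q⟫
    + 4 / (‖c p.1 - c q.1‖ ^ 2 - ζ) * (⟪c p.1 - c q.1, y p⟫ * ⟪c p.1 - c q.1, y q⟫)

/-- With d the difference of the means and s = ‖d‖² - ζ, the product in `dualSlack` expands to s +
2⟪d, y p⟫ - 2⟪d, y q⟫ - 4⟪d, y p⟫⟪d, y q⟫ / s. The linear terms are those of the squared distance;
the last one is cancelled in `dualForm`. -/
lemma normSq_sub_eq_dual {c : Fin k → EuclideanSpace ℝ (Fin m)}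
    {y : Fin k × Fin n → EuclideanSpace ℝ (Fin m)} {ζ : ℝ}
    (hs : ∀ a b, a ≠ b → ζ < ‖c a - c b‖ ^ 2) (p q : Fin k × Fin n) :
    ‖(c p.1 + y p) - (c q.1 + y q)‖ ^ 2 = dualSlack c y ζ p q + dualForm c y ζ p q
      - n * ζ * (if p = q then 1 else 0) + ζ + ‖y p‖ ^ 2 + ‖y q‖ ^ 2 := by
  have e : (c p.1 + y p) - (c q.1 + y q) = (c p.1 - c q.1) + (y p - y q) := by abel
  rw [e, norm_add_sq_real, norm_sub_sq_real (y p), inner_sub_right]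
  unfold dualSlack dualForm
  by_cases h : p.1 = q.1
  · simp [h]; ring
  · have := hs _ _ h
    have h2 : ‖c p.1 - c q.1‖ ^ 2 - ζ ≠ 0 := by linarith
    simp only [h, if_false]
    field_simp
    ring

/-- A linear map and its adjoint have the same norm: pair the sum with itself and apply
Cauchy–Schwarz. -/
lemma norm_sum_smul_sq_le {ι : Type*} [Fintype ι] {y : ι → EuclideanSpace ℝ (Fin m)} {M : ℝ}
    (hM : 0 ≤ M) (hy : ∀ v, ∑ i, ⟪y i, v⟫ ^ 2 ≤ M * ‖v‖ ^ 2) (w : ι → ℝ) :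
    ‖∑ i, w i • y i‖ ^ 2 ≤ M * ∑ i, w i ^ 2 := by
  set u := ∑ i, w i • y i with hu
  have h1 : ‖u‖ ^ 2 = ∑ i, w i * ⟪y i, u⟫ := by
    rw [← real_inner_self_eq_norm_sq]
    nth_rewrite 1 [hu]
    simp [sum_inner, real_inner_smul_left]
  have h2 := Finset.sum_mul_sq_le_sq_mul_sq univ w (fun i => ⟪y i, u⟫)
  rw [← h1] at h2
  have hw : 0 ≤ ∑ i, w i ^ 2 := sum_nonneg fun _ _ => sq_nonneg _
  have h3 : (‖u‖ ^ 2) ^ 2 ≤ (∑ i, w i ^ 2) * (M * ‖u‖ ^ 2) :=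
    h2.trans (mul_le_mul_of_nonneg_left (hy u) hw)
  rcases (sq_nonneg ‖u‖).eq_or_lt with h0 | h0
  · rw [← h0]; positivity
  · refine le_of_mul_le_mul_right ?_ h0
    nlinarith

/-- Since the `y i` sum to zero, `w` may be replaced by its deviation from its mean. The resulting
gain matches the within-cluster `-ζ` term of `dualForm`. -/
lemma norm_sum_smul_sq_le_of_sum_eq_zero {y : Fin n → EuclideanSpace ℝ (Fin m)} {M : ℝ}
    (hn : 0 < n) (hM : 0 ≤ M) (hy : ∀ v, ∑ i, ⟪y i, v⟫ ^ 2 ≤ M * ‖v‖ ^ 2)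
    (h0 : ∑ i, y i = 0) (w : Fin n → ℝ) :
    ‖∑ i, w i • y i‖ ^ 2 ≤ M * (∑ i, w i ^ 2 - (∑ i, w i) ^ 2 / n) := by
  have hn' : (n : ℝ) ≠ 0 := by positivity
  have h := norm_sum_smul_sq_le hM hy (fun i => w i - (∑ j, w j) / n)
  have e1 : ∑ i, (w i - (∑ j, w j) / n) • y i = ∑ i, w i • y i := by
    simp [sub_smul, ← Finset.smul_sum, h0]
  have e2 : ∑ i, (w i - (∑ j, w j) / n) ^ 2 = ∑ i, w i ^ 2 - (∑ i, w i) ^ 2 / n := by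
    simp only [sub_sq, sum_add_distrib, sum_sub_distrib, ← sum_mul, ← mul_sum, sum_const,
      card_univ, Fintype.card_fin, nsmul_eq_mul]
    field_simp
    ring
  rwa [e1, e2] at h

lemma sum_ite_eq_fst (f : Fin k × Fin n → ℝ) :
    ∑ p : Fin k × Fin n, ∑ q : Fin k × Fin n, f p * f q * (if p.1 = q.1 then 1 else 0)
      = ∑ a, (∑ i, f (a, i)) ^ 2 := by
  simp only [Fintype.sum_prod_type, mul_ite, mul_one, mul_zero]
  refine sum_congr rfl fun a _ => ?_
  rw [sq, sum_mul_sum]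
  refine sum_congr rfl fun i _ => ?_
  rw [sum_comm]
  simp

lemma dualForm_quadratic_eq (c : Fin k → EuclideanSpace ℝ (Fin m))
    (y : Fin k × Fin n → EuclideanSpace ℝ (Fin m)) (ζ : ℝ) (v : Fin k × Fin n → ℝ) :
    ∑ p, ∑ q, dualForm c y ζ p q * (v p * v q) =
      n * ζ * ∑ a, ∑ i, v (a, i) ^ 2 - ζ * ∑ a, (∑ i, v (a, i)) ^ 2
      - 2 * ‖∑ a, ∑ i, v (a, i) • y (a, i)‖ ^ 2
      + ∑ a, ∑ b, 4 / (‖c a - c b‖ ^ 2 - ζ) * (⟪c a - c b, ∑ i, v (a, i) • y (a, i)⟫ *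
          ⟪c a - c b, ∑ i, v (b, i) • y (b, i)⟫) := by
  have e1 : ∑ p : Fin k × Fin n, ∑ q, (v p * v q) * (if p = q then (1 : ℝ) else 0)
      = ∑ a, ∑ i, v (a, i) ^ 2 := by
    simp [Fintype.sum_prod_type, sq]
  have e3 : ∑ p : Fin k × Fin n, ∑ q, ⟪y p, y q⟫ * (v p * v q)
      = ‖∑ a, ∑ i, v (a, i) • y (a, i)‖ ^ 2 := by
    rw [← real_inner_self_eq_norm_sq, ← Fintype.sum_prod_type' (f := fun a i => v (a, i) • y (a, i))]
    simp only [sum_inner, inner_sum, real_inner_smul_left, real_inner_smul_right]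
    refine sum_congr rfl fun p _ => sum_congr rfl fun q _ => ?_
    rw [real_inner_comm]; ring
  have e4 : ∑ p : Fin k × Fin n, ∑ q : Fin k × Fin n, 4 / (‖c p.1 - c q.1‖ ^ 2 - ζ) *
        (⟪c p.1 - c q.1, y p⟫ * ⟪c p.1 - c q.1, y q⟫) * (v p * v q) =
      ∑ a, ∑ b, 4 / (‖c a - c b‖ ^ 2 - ζ) * (⟪c a - c b, ∑ i, v (a, i) • y (a, i)⟫ *
          ⟪c a - c b, ∑ i, v (b, i) • y (b, i)⟫) := by
    simp only [Fintype.sum_prod_type, inner_sum, real_inner_smul_right, sum_mul_sum]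
    simp only [mul_sum]
    refine sum_congr rfl fun a _ => ?_
    rw [sum_comm]
    refine sum_congr rfl fun b _ => sum_congr rfl fun i _ => sum_congr rfl fun j _ => ?_
    ring
  rw [← e1, ← sum_ite_eq_fst, ← e3, ← e4]
  simp only [mul_sum, ← sum_sub_distrib, ← sum_add_distrib]
  refine sum_congr rfl fun p _ => sum_congr rfl fun q _ => ?_
  unfold dualForm
  ring

lemma sum_offDiag_add_div_two (f : Fin k → ℝ) :
    ∑ a, ∑ b, (if a = b then 0 else (f a + f b) / 2) = (k - 1) * ∑ a, f a := by
  have h : ∀ a b : Fin k, (if a = b then 0 else (f a + f b) / 2)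
      = f a / 2 + f b / 2 - (if a = b then f a else 0) := by
    intro a b; split_ifs with h
    · subst h; ring
    · ring
  simp only [h, sum_sub_distrib, sum_add_distrib, sum_ite_eq, mem_univ, if_true, sum_const,
    card_univ, Fintype.card_fin, nsmul_eq_mul, ← mul_sum, ← sum_div]
  ring

/-- The `ζ` terms give `n * ζ * T`, where `T` is the total within-cluster deviation of `v`. The
negative terms cost at most 2k·S and (k - 1)κ·S, where `S ≤ n * L * T` by the centred bound. -/
lemma dualForm_quadratic_nonneg (hn : 0 < n) {c : Fin k → EuclideanSpace ℝ (Fin m)}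
    {y : Fin k × Fin n → EuclideanSpace ℝ (Fin m)} {ζ L κ : ℝ}
    (hy : ∀ a, ∑ i, y (a, i) = 0)
    (hs : ∀ a b, a ≠ b → ζ < ‖c a - c b‖ ^ 2)
    (hL : 0 ≤ L) (hyL : ∀ a v, ∑ i, ⟪y (a, i), v⟫ ^ 2 ≤ n * L * ‖v‖ ^ 2)
    (hk : 1 ≤ k) (hκ0 : 0 ≤ κ)
    (hκ : ∀ a b, a ≠ b → 4 * ‖c a - c b‖ ^ 2 ≤ κ * (‖c a - c b‖ ^ 2 - ζ))
    (hζ : L * (2 * k + (k - 1) * κ) ≤ ζ) (v : Fin k × Fin n → ℝ) :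
    0 ≤ ∑ p, ∑ q, dualForm c y ζ p q * (v p * v q) := by
  have hn' : (0 : ℝ) < n := by positivity
  have hk' : (1 : ℝ) ≤ k := by exact_mod_cast hk
  rw [dualForm_quadratic_eq]
  set w : Fin k → EuclideanSpace ℝ (Fin m) := fun a => ∑ i, v (a, i) • y (a, i) with hw
  have hwa : ∀ a, ‖w a‖ ^ 2 ≤ n * L * (∑ i, v (a, i) ^ 2 - (∑ i, v (a, i)) ^ 2 / n) := fun a =>
    norm_sum_smul_sq_le_of_sum_eq_zero hn (by positivity) (hyL a) (hy a) _
  set S := ∑ a, ‖w a‖ ^ 2 with hS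
  set T := ∑ a, (∑ i, v (a, i) ^ 2 - (∑ i, v (a, i)) ^ 2 / n) with hT
  have hST : S ≤ n * L * T := by
    rw [hS, hT, mul_sum]; exact sum_le_sum fun a _ => hwa a
  have hT0 : 0 ≤ T := sum_nonneg fun a _ => by
    have := sq_sum_le_card_mul_sum_sq (s := univ) (f := fun i => v (a, i))
    simp only [card_univ, Fintype.card_fin] at this
    rw [sub_nonneg, div_le_iff₀ hn']
    linarith
  have h1 : ‖∑ a, w a‖ ^ 2 ≤ k * S := by
    have h := norm_sum_le univ w
    have h2 := sq_sum_le_card_mul_sum_sq (s := univ) (f := fun a => ‖w a‖)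
    simp only [card_univ, Fintype.card_fin] at h2
    exact (pow_le_pow_left₀ (norm_nonneg _) h 2).trans h2
  have h2 : -((k - 1) * (κ * S)) ≤
      ∑ a, ∑ b, 4 / (‖c a - c b‖ ^ 2 - ζ) * (⟪c a - c b, w a⟫ * ⟪c a - c b, w b⟫) := by
    rw [hS, mul_sum, ← sum_offDiag_add_div_two, ← sum_neg_distrib]
    refine sum_le_sum fun a _ => ?_
    rw [← sum_neg_distrib]
    refine sum_le_sum fun b _ => ?_
    split_ifs with hab
    · simp [hab]
    · have hpos : 0 < ‖c a - c b‖ ^ 2 - ζ := by linarith [hs a b hab]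
      have ha := abs_real_inner_le_norm (c a - c b) (w a)
      have hb := abs_real_inner_le_norm (c a - c b) (w b)
      have hab' : |⟪c a - c b, w a⟫ * ⟪c a - c b, w b⟫| ≤
          ‖c a - c b‖ ^ 2 * (‖w a‖ * ‖w b‖) := by
        rw [abs_mul]
        calc _ ≤ (‖c a - c b‖ * ‖w a‖) * (‖c a - c b‖ * ‖w b‖) := by gcongr
          _ = _ := by ring
      have hκ' : 4 * ‖c a - c b‖ ^ 2 / (‖c a - c b‖ ^ 2 - ζ) ≤ κ :=
        (div_le_iff₀ hpos).2 (hκ a b hab)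
      have hww : ‖w a‖ * ‖w b‖ ≤ (‖w a‖ ^ 2 + ‖w b‖ ^ 2) / 2 := by
        nlinarith [sq_nonneg (‖w a‖ - ‖w b‖)]
      calc -((κ * ‖w a‖ ^ 2 + κ * ‖w b‖ ^ 2) / 2)
          = -(κ * ((‖w a‖ ^ 2 + ‖w b‖ ^ 2) / 2)) := by ring
        _ ≤ -(4 * ‖c a - c b‖ ^ 2 / (‖c a - c b‖ ^ 2 - ζ) * (‖w a‖ * ‖w b‖)) := by
            gcongr
        _ = 4 / (‖c a - c b‖ ^ 2 - ζ) * (-(‖c a - c b‖ ^ 2 * (‖w a‖ * ‖w b‖))) := by ring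
        _ ≤ _ := by
            gcongr
            exact (abs_le.1 hab').1
  have h3 : n * ζ * ∑ a, ∑ i, v (a, i) ^ 2 - ζ * ∑ a, (∑ i, v (a, i)) ^ 2 = n * ζ * T := by
    rw [hT, sum_sub_distrib, ← sum_div]; field_simp
  rw [h3]
  have h4 : (2 * k + (k - 1) * κ) * S ≤ (2 * k + (k - 1) * κ) * (n * L * T) := by
    have : 0 ≤ ((k : ℝ) - 1) * κ := mul_nonneg (by linarith) hκ0
    gcongr
  have h5 : n * T * (L * (2 * k + (k - 1) * κ)) ≤ n * T * ζ := by gcongr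
  nlinarith

open scoped MatrixOrder in
lemma exists_gram_of_posSemidef {ι : Type*} [Fintype ι] {X : Matrix ι ι ℝ} (hX : X.PosSemidef) :
    ∃ G : ι → ι → ℝ, ∀ p q, X p q = ∑ t, G t p * G t q := by
  classical
  obtain ⟨G, hG⟩ := CStarAlgebra.nonneg_iff_eq_star_mul_self.1 (Matrix.nonneg_iff_posSemidef.2 hX)
  refine ⟨G, fun p q => ?_⟩
  rw [hG, Matrix.star_eq_conjTranspose, Matrix.mul_apply]
  simp

lemma sum_mul_nonneg_of_posSemidef {ι : Type*} [Fintype ι] {Q : ι → ι → ℝ} {X : Matrix ι ι ℝ}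
    (hQ : ∀ v : ι → ℝ, 0 ≤ ∑ p, ∑ q, Q p q * (v p * v q)) (hX : X.PosSemidef) :
    0 ≤ ∑ p, ∑ q, Q p q * X p q := by
  obtain ⟨G, hG⟩ := exists_gram_of_posSemidef hX
  have : ∑ p, ∑ q, Q p q * X p q = ∑ t, ∑ p, ∑ q, Q p q * (G t p * G t q) := by
    simp only [hG, mul_sum]
    rw [sum_comm (s := univ (α := ι))]
    rw [sum_comm]
    symm
    rw [sum_comm]
    exact sum_congr rfl fun p _ => sum_comm
  rw [this]
  exact sum_nonneg fun t _ => hQ (G t)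

lemma plantedMatrix_apply (p q : Fin k × Fin n) :
    plantedMatrix k n p q = if p.1 = q.1 then 1 / (n : ℝ) else 0 := by
  simp [plantedMatrix, Matrix.sum_apply, Matrix.vecMulVec_apply, clusterIndicator, eq_comm]

lemma sum_ite_fst_eq (a : Fin k) (t : ℝ) :
    ∑ q : Fin k × Fin n, (if a = q.1 then t else 0) = n * t := by
  simp [Fintype.sum_prod_type_right]

lemma sum_same_cluster (f : Fin k × Fin n → ℝ) :
    ∑ p : Fin k × Fin n, ∑ q : Fin k × Fin n, (if p.1 = q.1 then f p else 0) = n * ∑ p, f p := by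
  simp only [sum_ite_fst_eq, mul_sum]

lemma isFeasible_plantedMatrix (hn : 0 < n) : IsFeasible k (plantedMatrix k n) where
  trace_eq := by
    have : (n : ℝ) ≠ 0 := by positivity
    simp [Matrix.trace, plantedMatrix_apply, this]
  mulVec_one := by
    have : (n : ℝ) ≠ 0 := by positivity
    ext p
    simp [Matrix.mulVec, dotProduct, plantedMatrix_apply, sum_ite_fst_eq, this]
  nonneg p q := by rw [plantedMatrix_apply]; positivity
  posSemidef := by
    refine Matrix.posSemidef_sum _ fun a _ => ?_
    refine Matrix.PosSemidef.smul ?_ (by positivity)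
    simpa using Matrix.posSemidef_vecMulVec_self_star (clusterIndicator n a)

lemma IsFeasible.sum_row {ι : Type*} [Fintype ι] {X : Matrix ι ι ℝ} (hX : IsFeasible k X) (p : ι) :
    ∑ q, X p q = 1 := by
  simpa [Matrix.mulVec, dotProduct] using congrFun hX.mulVec_one p

lemma IsFeasible.symm {ι : Type*} [Fintype ι] {X : Matrix ι ι ℝ} (hX : IsFeasible k X) (p q : ι) :
    X p q = X q p := by
  simpa using (hX.posSemidef.isHermitian.apply p q).symm

/-- Write X as a Gram matrix. The squared distances between Gram vectors, summed over pairs in a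
common cluster, equal 2nk - 2nk = 0 by the trace and row-sum constraints. Hence X is constant on
each block, and the row sums give 1/n. -/
lemma IsFeasible.eq_plantedMatrix (hn : 0 < n) {X : Matrix (Fin k × Fin n) (Fin k × Fin n) ℝ}
    (hX : IsFeasible k X) (h0 : ∀ p q, p.1 ≠ q.1 → X p q = 0) : X = plantedMatrix k n := by
  have hn' : (n : ℝ) ≠ 0 := by positivity
  obtain ⟨G, hG⟩ := exists_gram_of_posSemidef hX.posSemidef
  have hF : ∀ p q, X p p + X q q - 2 * X p q = ∑ t, (G t p - G t q) ^ 2 := by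
    intro p q
    simp only [hG, mul_sum, ← sum_add_distrib, ← sum_sub_distrib]
    exact sum_congr rfl fun t _ => by ring
  have hF0 : ∀ p q, 0 ≤ (if p.1 = q.1 then X p p + X q q - 2 * X p q else 0) := by
    intro p q
    split_ifs
    · rw [hF]; exact sum_nonneg fun _ _ => sq_nonneg _
    · rfl
  have htr : ∑ p, X p p = k := hX.trace_eq
  have hsum : ∑ p, ∑ q, (if p.1 = q.1 then X p p + X q q - 2 * X p q else 0) = 0 := by
    have e : ∀ p q : Fin k × Fin n, (if p.1 = q.1 then X p p + X q q - 2 * X p q else 0)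
        = (if p.1 = q.1 then X p p else 0) + (if q.1 = p.1 then X q q else 0) - 2 * X p q := by
      intro p q
      by_cases h : p.1 = q.1
      · simp [h]
      · simp [h, Ne.symm h, h0 p q h]
    simp only [e, sum_sub_distrib, sum_add_distrib, ← mul_sum, hX.sum_row]
    rw [sum_same_cluster fun p => X p p, sum_comm, sum_same_cluster fun p => X p p, htr]
    simp
    ring
  have hconst : ∀ p q, p.1 = q.1 → ∀ t, G t p = G t q := by
    intro p q hpq t
    have h1 := (sum_eq_zero_iff_of_nonneg fun p _ => sum_nonneg fun q _ => hF0 p q).1 hsum p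
      (mem_univ _)
    have h2 := (sum_eq_zero_iff_of_nonneg fun q _ => hF0 p q).1 h1 q (mem_univ _)
    rw [if_pos hpq, hF] at h2
    have h3 := (sum_eq_zero_iff_of_nonneg fun _ _ => sq_nonneg _).1 h2 t (mem_univ _)
    exact sub_eq_zero.1 (pow_eq_zero_iff two_ne_zero |>.1 h3)
  ext p q
  rw [plantedMatrix_apply]
  split_ifs with h
  · have h1 := hX.sum_row p
    have h2 : ∀ r, X p r = if p.1 = r.1 then X p q else 0 := by
      intro r
      split_ifs with hr
      · rw [hG, hG]
        exact sum_congr rfl fun t _ => by rw [hconst q r (h.symm.trans hr)]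
      · exact h0 p r hr
    rw [sum_congr rfl fun r _ => h2 r] at h1
    rw [sum_ite_fst_eq] at h1
    field_simp
    linarith
  · exact h0 p q h

/-- The value of the dual certificate on feasible matrices. -/
lemma IsFeasible.trace_sqDistMatrix_mul {c : Fin k → EuclideanSpace ℝ (Fin m)}
    {y : Fin k × Fin n → EuclideanSpace ℝ (Fin m)} {ζ : ℝ}
    (hs : ∀ a b, a ≠ b → ζ < ‖c a - c b‖ ^ 2)
    {X : Matrix (Fin k × Fin n) (Fin k × Fin n) ℝ} (hX : IsFeasible k X) :
    (sqDistMatrix (fun p => c p.1 + y p) * X).trace =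
      ∑ p, ∑ q, dualSlack c y ζ p q * X p q + ∑ p, ∑ q, dualForm c y ζ p q * X p q
        + 2 * ∑ p, ‖y p‖ ^ 2 := by
  have htr : ∑ p, X p p = k := hX.trace_eq
  have e : ∀ p q, sqDistMatrix (fun p => c p.1 + y p) p q * X q p =
      dualSlack c y ζ p q * X p q + dualForm c y ζ p q * X p q
        - n * ζ * (if p = q then X p q else 0) + ζ * X p q + ‖y p‖ ^ 2 * X p q
        + ‖y q‖ ^ 2 * X q p := by
    intro p q
    rw [sqDistMatrix, Matrix.of_apply, normSq_sub_eq_dual hs, hX.symm q p]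
    split_ifs <;> ring
  have e5 : ∑ p, ∑ q, ‖y q‖ ^ 2 * X q p = ∑ q, ‖y q‖ ^ 2 := by
    rw [sum_comm]
    simp only [← mul_sum, hX.sum_row, mul_one]
  simp only [Matrix.trace, Matrix.diag_apply, Matrix.mul_apply, e, sum_add_distrib,
    sum_sub_distrib, e5]
  -- The trace contributes -nζ·k and the total mass ζ·kn, so `ζ` drops out.
  simp only [← mul_sum, hX.sum_row, sum_ite_eq, mem_univ, if_true, htr, mul_one]
  simp
  ring

lemma sum_dualSlack_plantedMatrix (c : Fin k → EuclideanSpace ℝ (Fin m))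
    (y : Fin k × Fin n → EuclideanSpace ℝ (Fin m)) (ζ : ℝ) :
    ∑ p, ∑ q, dualSlack c y ζ p q * plantedMatrix k n p q = 0 := by
  refine sum_eq_zero fun p _ => sum_eq_zero fun q _ => ?_
  rw [dualSlack, plantedMatrix_apply]
  split_ifs <;> simp

/-- Within a block the two `ζ` terms cancel on each row, and centring kills the inner products. -/
lemma sum_dualForm_plantedMatrix (c : Fin k → EuclideanSpace ℝ (Fin m))
    {y : Fin k × Fin n → EuclideanSpace ℝ (Fin m)} (hy : ∀ a, ∑ i, y (a, i) = 0) (ζ : ℝ) :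
    ∑ p, ∑ q, dualForm c y ζ p q * plantedMatrix k n p q = 0 := by
  simp only [Fintype.sum_prod_type]
  refine sum_eq_zero fun a _ => ?_
  have : ∀ i, ∑ b, ∑ j, dualForm c y ζ (a, i) (b, j) * plantedMatrix k n (a, i) (b, j)
      = - (2 / n) * ⟪y (a, i), ∑ j, y (a, j)⟫ := by
    intro i
    have hn' : (n : ℝ) ≠ 0 := by have := i.pos; positivity
    rw [sum_eq_single a]
    · simp only [dualForm, plantedMatrix_apply, if_true, sub_self, inner_zero_left, mul_zero,
        add_zero, inner_sum, mul_sum, sub_mul, sum_sub_distrib]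
      simp [← mul_sum, ← sum_mul]
      field_simp
      ring
    · intro b _ hb
      simp [plantedMatrix_apply, hb.symm]
    · simp
  simp [this, hy]

theorem recoversPlanted_of_certificate (hn : 0 < n) {c : Fin k → EuclideanSpace ℝ (Fin m)}
    {y : Fin k × Fin n → EuclideanSpace ℝ (Fin m)} {ζ L κ : ℝ}
    (hy : ∀ a, ∑ i, y (a, i) = 0)
    (hs : ∀ a b, a ≠ b → ζ < ‖c a - c b‖ ^ 2)
    (hpos : ∀ a b i, a ≠ b → 0 < ‖c a - c b‖ ^ 2 - ζ + 2 * ⟪c a - c b, y (a, i)⟫)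
    (hL : 0 ≤ L) (hyL : ∀ a v, ∑ i, ⟪y (a, i), v⟫ ^ 2 ≤ n * L * ‖v‖ ^ 2)
    (hk : 1 ≤ k) (hκ0 : 0 ≤ κ)
    (hκ : ∀ a b, a ≠ b → 4 * ‖c a - c b‖ ^ 2 ≤ κ * (‖c a - c b‖ ^ 2 - ζ))
    (hζ : L * (2 * k + (k - 1) * κ) ≤ ζ) :
    RecoversPlanted (fun p : Fin k × Fin n => c p.1 + y p) := by
  have hQ : ∀ {X}, IsFeasible k X → 0 ≤ ∑ p, ∑ q, dualForm c y ζ p q * X p q := fun hX =>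
    sum_mul_nonneg_of_posSemidef (dualForm_quadratic_nonneg hn hy hs hL hyL hk hκ0 hκ hζ)
      hX.posSemidef
  have hB : ∀ p q, p.1 ≠ q.1 → 0 < dualSlack c y ζ p q := by
    intro p q hpq
    rw [dualSlack, if_neg hpq]
    refine div_pos (mul_pos (hpos _ _ p.2 hpq) ?_) (by linarith [hs _ _ hpq])
    have h := hpos _ _ q.2 (Ne.symm hpq)
    rw [← neg_sub (c p.1) (c q.1), norm_neg, inner_neg_left] at h
    linarith
  have hB0 : ∀ p q, 0 ≤ dualSlack c y ζ p q := by
    intro p q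
    by_cases h : p.1 = q.1
    · simp [dualSlack, h]
    · exact (hB p q h).le
  have hBX : ∀ {X}, IsFeasible k X → ∀ p q, 0 ≤ dualSlack c y ζ p q * X p q :=
    fun hX p q => mul_nonneg (hB0 p q) (hX.nonneg p q)
  have hP := isFeasible_plantedMatrix (k := k) hn
  have hval : (sqDistMatrix (fun p => c p.1 + y p) * plantedMatrix k n).trace
      = 2 * ∑ p, ‖y p‖ ^ 2 := by
    rw [hP.trace_sqDistMatrix_mul hs, sum_dualSlack_plantedMatrix, sum_dualForm_plantedMatrix c hy]
    ring
  intro X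
  constructor
  · rintro ⟨hX, hmax⟩
    refine hX.eq_plantedMatrix hn fun p q hpq => ?_
    have h := hmax _ hP
    rw [hval, hX.trace_sqDistMatrix_mul hs] at h
    have h0 : ∑ p, ∑ q, dualSlack c y ζ p q * X p q = 0 :=
      le_antisymm (by linarith [hQ hX]) (sum_nonneg fun p _ => sum_nonneg fun q _ => hBX hX p q)
    have h1 := (sum_eq_zero_iff_of_nonneg fun p _ => sum_nonneg fun q _ => hBX hX p q).1 h0 p
      (mem_univ _)
    have h2 := (sum_eq_zero_iff_of_nonneg fun q _ => hBX hX p q).1 h1 q (mem_univ _)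
    exact (mul_eq_zero.1 h2).resolve_left (hB p q hpq).ne'
  · rintro rfl
    refine ⟨hP, fun Y hY => ?_⟩
    rw [hval, hY.trace_sqDistMatrix_mul hs]
    linarith [hQ hY, sum_nonneg fun p (_ : p ∈ univ) => sum_nonneg fun q (_ : q ∈ univ) =>
      hBX hY p q]

end Deterministic
end KMeansSDP

namespace KMeansSDP

open Finset RealInnerProductSpace ProbabilityTheory

/-! ### Hoeffding bounds for samples from the product measure. -/

section Concentration

variable {E : Type*} [MeasurableSpace E]

lemma measureReal_sum_sub_integral_ge_le {ι : Type*} [Fintype ι] (μ : Measure E)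
    [IsProbabilityMeasure μ] {g : E → ℝ} (hg : Measurable g) (hb : ∀ᵐ x ∂μ, |g x| ≤ 1)
    (s : Finset ι) {t : ℝ} (ht : 0 ≤ t) :
    (Measure.pi fun _ : ι => μ).real {r | t ≤ ∑ i ∈ s, (g (r i) - ∫ x, g x ∂μ)} ≤
      Real.exp (-t ^ 2 / (2 * #s)) := by
  have hsub : HasSubgaussianMGF (fun x => g x - ∫ x, g x ∂μ) 1 μ := by
    -- An interval of length 2 gives variance proxy (2/2)² = 1.
    have h := hasSubgaussianMGF_of_mem_Icc (a := -1) (b := 1) hg.aemeasurable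
      (hb.mono fun x hx => abs_le.1 hx)
    convert h using 1
    norm_num
  have hind := iIndepFun_pi (μ := fun _ : ι => μ) (X := fun _ x => g x - ∫ x, g x ∂μ)
    fun _ => (hg.sub_const _).aemeasurable
  have hs : ∀ i ∈ s, HasSubgaussianMGF (fun r : ι → E => g (r i) - ∫ x, g x ∂μ) 1
      (Measure.pi fun _ : ι => μ) := fun i _ =>
    HasSubgaussianMGF.of_map (X := fun x => g x - ∫ x, g x ∂μ) (Y := fun r : ι → E => r i)
      (measurable_pi_apply i).aemeasurable
      (by rw [(measurePreserving_eval (fun _ : ι => μ) i).map_eq]; exact hsub)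
  simpa using HasSubgaussianMGF.measure_sum_ge_le_of_iIndepFun hind hs ht

/-- Uniform law of large numbers for finitely many bounded functions on `k` independent samples,
with an exponentially small probability of failure. -/
lemma exists_measure_exists_abs_sum_gt_le {J : Type*} [Fintype J] {k : ℕ} (μ : Measure E)
    [IsProbabilityMeasure μ] {g : J → E → ℝ} (hg : ∀ j, Measurable (g j))
    (hb : ∀ j, ∀ᵐ x ∂μ, |g j x| ≤ 1) {ε : ℝ} (hε : 0 < ε) :
    ∃ c : ℝ, 0 < c ∧ ∀ᶠ n : ℕ in atTop,
      (Measure.pi fun _ : Fin k × Fin n => μ)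
        {r | ∃ a j, ε * n < |∑ i, (g j (r (a, i)) - ∫ x, g j x ∂μ)|} ≤
      ENNReal.ofReal (Real.exp (-(c * n))) := by
  have key : ∀ (n : ℕ), 0 < n → (Measure.pi fun _ : Fin k × Fin n => μ).real
      {r | ∃ a j, ε * n < |∑ i, (g j (r (a, i)) - ∫ x, g j x ∂μ)|} ≤
        (k * Fintype.card J * 2) * Real.exp (-(ε ^ 2 / 2 * n)) := by
    intro n hn
    have hn' : (n : ℝ) ≠ 0 := by positivity
    have hone : ∀ (a : Fin k) (f : E → ℝ), Measurable f → (∀ᵐ x ∂μ, |f x| ≤ 1) →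
        (Measure.pi fun _ : Fin k × Fin n => μ).real
          {r | ε * n ≤ ∑ i, (f (r (a, i)) - ∫ x, f x ∂μ)} ≤ Real.exp (-(ε ^ 2 / 2 * n)) := by
      intro a f hf hfb
      have h := measureReal_sum_sub_integral_ge_le (ι := Fin k × Fin n) μ hf hfb
        (univ.map ⟨fun i => (a, i), Prod.mk_right_injective a⟩) (t := ε * n) (by positivity)
      simp only [sum_map, Function.Embedding.coeFn_mk, card_map, card_univ, Fintype.card_fin] at h
      convert h using 2
      field_simp
    have hsub : {r : Fin k × Fin n → E | ∃ a j, ε * n < |∑ i, (g j (r (a, i)) - ∫ x, g j x ∂μ)|} ⊆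
        ⋃ a : Fin k, ⋃ j : J, ({r | ε * n ≤ ∑ i, (g j (r (a, i)) - ∫ x, g j x ∂μ)} ∪
          {r | ε * n ≤ ∑ i, (-g j (r (a, i)) - ∫ x, -g j x ∂μ)}) := by
      rintro r ⟨a, j, h⟩
      simp only [Set.mem_iUnion]
      refine ⟨a, j, ?_⟩
      rcases lt_abs.1 h with h | h
      · exact Or.inl h.le
      · right
        simp only [Set.mem_ofPred_eq, integral_neg]
        refine h.le.trans (le_of_eq ?_)
        rw [← sum_neg_distrib]
        exact sum_congr rfl fun i _ => by ring
    refine (measureReal_mono hsub).trans ?_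
    refine (measureReal_iUnion_fintype_le _).trans ?_
    calc _ ≤ ∑ a : Fin k, ∑ j : J, (2 * Real.exp (-(ε ^ 2 / 2 * n))) := by
          refine sum_le_sum fun a _ => (measureReal_iUnion_fintype_le _).trans ?_
          refine sum_le_sum fun j _ => (measureReal_union_le _ _).trans ?_
          have h1 := hone a (g j) (hg j) (hb j)
          have h2 := hone a (fun x => -g j x) (hg j).neg (by simpa using hb j)
          linarith
      _ = _ := by simp; ring
  -- Half of the Hoeffding rate ε²/2 is given up to absorb the union-bound prefactor for large n.
  refine ⟨ε ^ 2 / 4, by positivity, ?_⟩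
  have hlim : Tendsto (fun n : ℕ => Real.exp (-(ε ^ 2 / 4 * n))) atTop (nhds 0) := by
    refine Real.tendsto_exp_neg_atTop_nhds_zero.comp ?_
    exact Tendsto.const_mul_atTop (by positivity) tendsto_natCast_atTop_atTop
  have hlim2 := hlim.const_mul ((k : ℝ) * Fintype.card J * 2)
  rw [mul_zero] at hlim2
  filter_upwards [hlim2.eventually (gt_mem_nhds one_pos), eventually_gt_atTop 0] with n h1 hn
  rw [← ofReal_measureReal]
  refine ENNReal.ofReal_le_ofReal ((key n hn).trans ?_)
  have : Real.exp (-(ε ^ 2 / 2 * n)) = Real.exp (-(ε ^ 2 / 4 * n)) * Real.exp (-(ε ^ 2 / 4 * n)) := by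
    rw [← Real.exp_add]; congr 1; ring
  rw [this, ← mul_assoc]
  exact mul_le_of_le_one_left (Real.exp_pos _).le h1.le

end Concentration

/-! ### First and second moments of a rotation-invariant law. -/

section Moments

variable {m : ℕ} {𝒟 : Measure (EuclideanSpace ℝ (Fin m))}

lemma RotationInvariant.integral_comp (h : RotationInvariant 𝒟)
    (U : EuclideanSpace ℝ (Fin m) ≃ₗᵢ[ℝ] EuclideanSpace ℝ (Fin m))
    (f : EuclideanSpace ℝ (Fin m) → ℝ) : ∫ x, f (U x) ∂𝒟 = ∫ x, f x ∂𝒟 := by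
  conv_rhs => rw [← h U]
  exact (U.toHomeomorph.measurableEmbedding.integral_map f).symm

lemma RotationInvariant.integral_coord (h : RotationInvariant 𝒟) (p : Fin m) :
    ∫ x, x p ∂𝒟 = 0 := by
  have := h.integral_comp (LinearIsometryEquiv.neg ℝ) fun x => x p
  simp [integral_neg] at this
  linarith

lemma RotationInvariant.integral_coord_mul_coord (h : RotationInvariant 𝒟) {p q : Fin m}
    (hpq : p ≠ q) : ∫ x, x p * x q ∂𝒟 = 0 := by
  have := h.integral_comp (LinearIsometryEquiv.piLpCongrRight 2 fun i =>
    if i = p then LinearIsometryEquiv.neg ℝ else LinearIsometryEquiv.refl ℝ ℝ) fun x => x p * x q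
  simp [hpq.symm, integral_neg] at this
  linarith

lemma RotationInvariant.integral_coord_sq (h : RotationInvariant 𝒟) (p q : Fin m) :
    ∫ x, x p * x p ∂𝒟 = ∫ x, x q * x q ∂𝒟 := by
  have := h.integral_comp (LinearIsometryEquiv.piLpCongrLeft 2 ℝ ℝ (Equiv.swap p q))
    fun x => x p * x p
  rw [← this]
  simp [LinearIsometryEquiv.piLpCongrLeft_apply, Equiv.piCongrLeft']

lemma abs_coord_le_norm (x : EuclideanSpace ℝ (Fin m)) (p : Fin m) : |x p| ≤ ‖x‖ :=
  PiLp.norm_apply_le x p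

lemma RotationInvariant.integral_coord_sq_le [IsProbabilityMeasure 𝒟] (h : RotationInvariant 𝒟)
    (hsupp : SupportedOnUnitBall 𝒟) (p : Fin m) : ∫ x, x p * x p ∂𝒟 ≤ 1 / m := by
  have hm : (0 : ℝ) < m := by have := p.pos; positivity
  have hint : ∀ q : Fin m, Integrable (fun x : EuclideanSpace ℝ (Fin m) => x q * x q) 𝒟 := by
    intro q
    refine Integrable.of_bound (C := 1) (by fun_prop) (hsupp.mono fun x hx => ?_)
    rw [norm_mul]
    have := (abs_coord_le_norm x q).trans hx
    exact mul_le_one₀ this (norm_nonneg _) this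
  have h1 : ∫ x, ‖x‖ ^ 2 ∂𝒟 = m * ∫ x, x p * x p ∂𝒟 := by
    have : ∀ x : EuclideanSpace ℝ (Fin m), ‖x‖ ^ 2 = ∑ q, x q * x q := by
      intro x; rw [EuclideanSpace.real_norm_sq_eq]; simp only [sq]
    simp only [this]
    rw [integral_finsetSum _ fun q _ => hint q]
    simp [h.integral_coord_sq _ p]
  have h2 : ∫ x, ‖x‖ ^ 2 ∂𝒟 ≤ 1 := by
    have : ∫ x, ‖x‖ ^ 2 ∂𝒟 ≤ ∫ _, (1 : ℝ) ∂𝒟 := by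
      refine integral_mono_of_nonneg (ae_of_all _ fun x => by positivity) (integrable_const _)
        (hsupp.mono fun x hx => ?_)
      exact pow_le_one₀ (norm_nonneg _) hx
    simpa using this
  rw [le_div_iff₀ hm]
  linarith

end Moments
end KMeansSDP

namespace KMeansSDP

open Finset RealInnerProductSpace

/-! ### From empirical moments to the certificate. -/

section Sample

variable {m k n : ℕ}

lemma norm_le_of_abs_coord_le {v : EuclideanSpace ℝ (Fin m)} {δ : ℝ} (h : ∀ p, |v p| ≤ δ) :
    ‖v‖ ≤ m * δ := by
  have h1 : ‖v‖ ^ 2 ≤ (∑ p, |v p|) ^ 2 := by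
    rw [EuclideanSpace.real_norm_sq_eq]
    simpa using sum_sq_le_sq_sum_of_nonneg (s := univ) (f := fun p => |v p|)
      fun p _ => abs_nonneg _
  refine (abs_le_of_sq_le_sq' h1 (sum_nonneg fun _ _ => abs_nonneg _)).2.trans ?_
  simpa using sum_le_sum fun p (_ : p ∈ univ) => h p

/-- An entrywise error `δ` in the covariance costs `m * δ` as a quadratic form, because (∑ |v p|)² ≤
m‖v‖². -/
lemma sum_inner_sq_le {r : Fin n → EuclideanSpace ℝ (Fin m)} {M : Fin m → Fin m → ℝ} {τ δ : ℝ}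
    (hδ : 0 ≤ δ) (hM : ∀ p q, p ≠ q → M p q = 0) (hMτ : ∀ p, M p p ≤ τ)
    (h : ∀ p q, |∑ i, (r i p * r i q - M p q)| ≤ δ * n) (v : EuclideanSpace ℝ (Fin m)) :
    ∑ i, ⟪r i, v⟫ ^ 2 ≤ n * (τ + m * δ) * ‖v‖ ^ 2 := by
  have hv : ‖v‖ ^ 2 = ∑ p, v p ^ 2 := EuclideanSpace.real_norm_sq_eq v
  have e : ∑ i, ⟪r i, v⟫ ^ 2 = n * ∑ p, M p p * v p ^ 2
      + ∑ p, ∑ q, v p * v q * ∑ i, (r i p * r i q - M p q) := by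
    have e1 : ∀ i, ⟪r i, v⟫ ^ 2 = ∑ p, ∑ q, v p * v q * (r i p * r i q) := by
      intro i
      rw [PiLp.inner_apply, sq, sum_mul_sum]
      refine sum_congr rfl fun p _ => sum_congr rfl fun q _ => ?_
      simp
      ring
    have e2 : ∑ p, ∑ q, v p * v q * M p q = ∑ p, M p p * v p ^ 2 := by
      refine sum_congr rfl fun p _ => ?_
      rw [sum_eq_single p (fun q _ hq => by rw [hM p q hq.symm, mul_zero]) (by simp)]
      ring
    simp only [sum_sub_distrib, mul_sub, sum_const, card_univ, Fintype.card_fin, nsmul_eq_mul]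
    have e3 : ∑ p, ∑ q, v p * v q * (n * M p q) = n * ∑ p, ∑ q, v p * v q * M p q := by
      simp only [mul_sum]
      exact sum_congr rfl fun p _ => sum_congr rfl fun q _ => by ring
    rw [e3, e2, add_sub_cancel]
    simp only [e1, mul_sum]
    rw [sum_comm]
    exact sum_congr rfl fun p _ => sum_comm
  have h1 : ∑ p, M p p * v p ^ 2 ≤ τ * ‖v‖ ^ 2 := by
    rw [hv, mul_sum]
    exact sum_le_sum fun p _ => mul_le_mul_of_nonneg_right (hMτ p) (sq_nonneg _)
  have h2 : ∑ p, ∑ q, v p * v q * ∑ i, (r i p * r i q - M p q) ≤ δ * n * (∑ p, |v p|) ^ 2 := by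
    rw [sq, sum_mul_sum, mul_sum]
    refine sum_le_sum fun p _ => ?_
    rw [mul_sum]
    refine sum_le_sum fun q _ => (le_abs_self _).trans ?_
    rw [abs_mul, abs_mul, mul_comm]
    exact mul_le_mul_of_nonneg_right (h p q) (by positivity)
  have h3 : (∑ p, |v p|) ^ 2 ≤ m * ‖v‖ ^ 2 := by
    simpa [hv] using sq_sum_le_card_mul_sum_sq (s := univ) (f := fun p => |v p|)
  rw [e]
  calc _ ≤ n * (τ * ‖v‖ ^ 2) + δ * n * (m * ‖v‖ ^ 2) := by gcongr; exact h2.trans (by gcongr)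
    _ = _ := by ring

/-- Both inequalities are strict at η = 0, hence persist for small positive η by continuity. -/
lemma exists_slack (hk : 2 ≤ k) (hm : 0 < m) {Δ : ℝ} (hΔ : 2 + (k : ℝ) ^ 2 / m < Δ) :
    ∃ η : ℝ, 0 < η ∧ 2 * (1 + 2 * η) < Δ - 2 * η ∧
      (1 / m + η) * (2 * k + (k - 1) * (2 * (Δ - 2 * η))) <
        (Δ - 2 * η) ^ 2 - 2 * (Δ - 2 * η) * (1 + 2 * η) := by
  have hm' : (0 : ℝ) < m := by positivity
  have hk' : (2 : ℝ) ≤ k := by exact_mod_cast hk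
  have hΔ2 : 2 < Δ := lt_of_le_of_lt (by simp; positivity) hΔ
  have h1 : ∀ᶠ η : ℝ in nhds 0, 2 * (1 + 2 * η) < Δ - 2 * η := by
    refine ContinuousAt.eventually_lt (by fun_prop) (by fun_prop) ?_
    linarith
  have h2 : ∀ᶠ η : ℝ in nhds 0, (1 / m + η) * (2 * k + (k - 1) * (2 * (Δ - 2 * η))) <
        (Δ - 2 * η) ^ 2 - 2 * (Δ - 2 * η) * (1 + 2 * η) := by
    refine ContinuousAt.eventually_lt (by fun_prop) (by fun_prop) ?_
    have h3 : (k : ℝ) ^ 2 / m * Δ < (Δ - 2) * Δ := by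
      refine mul_lt_mul_of_pos_right ?_ (by linarith)
      linarith
    -- The difference of the numerators is (k - 1)(k - 2)Δ + k(Δ - 2).
    have h4 : (2 * k + (k - 1) * (2 * Δ)) / m ≤ (k : ℝ) ^ 2 / m * Δ := by
      rw [div_mul_eq_mul_div]
      gcongr
      nlinarith [mul_nonneg (sub_nonneg.2 hk') (by linarith : (0 : ℝ) ≤ k - 1),
        mul_nonneg (mul_nonneg (sub_nonneg.2 hk') (by linarith : (0 : ℝ) ≤ k - 1))
          (by linarith : 0 ≤ Δ)]
    have h5 : (1 / (m : ℝ) + 0) * (2 * k + (k - 1) * (2 * (Δ - 2 * 0)))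
        = (2 * k + (k - 1) * (2 * Δ)) / m := by ring
    rw [h5]
    linarith
  obtain ⟨η, ⟨ha, hb⟩, hc⟩ := (((h1.and h2).filter_mono nhdsWithin_le_nhds).and
    (self_mem_nhdsWithin (a := (0 : ℝ)) (s := Set.Ioi 0))).exists
  exact ⟨η, hc, ha, hb⟩

lemma recoversPlanted_of_sample (hn : 0 < n) (hk : 1 ≤ k) {γ : Fin k → EuclideanSpace ℝ (Fin m)}
    {r : Fin k × Fin n → EuclideanSpace ℝ (Fin m)} {Δ η τ : ℝ} (hη : 0 < η) (hτ : 0 ≤ τ)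
    (hΔ : ∀ a b, a ≠ b → Δ ≤ ‖γ a - γ b‖)
    (h1 : 2 * (1 + 2 * η) < Δ - 2 * η)
    (h2 : (τ + η) * (2 * k + (k - 1) * (2 * (Δ - 2 * η))) ≤
        (Δ - 2 * η) ^ 2 - 2 * (Δ - 2 * η) * (1 + 2 * η))
    (hr : ∀ p, ‖r p‖ ≤ 1) (hmean : ∀ a, ‖(n : ℝ)⁻¹ • ∑ i, r (a, i)‖ ≤ η)
    (hmom : ∀ a v, ∑ i, ⟪r (a, i), v⟫ ^ 2 ≤ n * (τ + η) * ‖v‖ ^ 2) :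
    RecoversPlanted (fun p : Fin k × Fin n => r p + γ p.1) := by
  have hn' : (n : ℝ) ≠ 0 := by positivity
  set μ : Fin k → EuclideanSpace ℝ (Fin m) := fun a => (n : ℝ)⁻¹ • ∑ i, r (a, i) with hμ
  have hsum : ∀ a, ∑ i, r (a, i) = (n : ℝ) • μ a := fun a => by
    simp [hμ, smul_smul, hn']
  set D := Δ - 2 * η with hD
  have hfun : (fun p : Fin k × Fin n => r p + γ p.1)
      = fun p => (γ p.1 + μ p.1) + (r p - μ p.1) := by
    funext p; abel
  have hd : ∀ a b, a ≠ b → D ≤ ‖(γ a + μ a) - (γ b + μ b)‖ := by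
    intro a b hab
    have e : γ a - γ b = ((γ a + μ a) - (γ b + μ b)) + (μ b - μ a) := by abel
    have t1 := norm_add_le ((γ a + μ a) - (γ b + μ b)) (μ b - μ a)
    rw [← e] at t1
    have t2 := norm_sub_le (μ b) (μ a)
    linarith [hΔ a b hab, hmean a, hmean b]
  rw [hfun]
  -- At ‖d‖ = D this `ζ` leaves ‖d‖² - ζ = 2D(1 + 2η), just above the worst inner-product loss 2D(1
  -- + η). There 4‖d‖² / (‖d‖² - ζ) = 2D / (1 + 2η), whence `κ`.
  refine recoversPlanted_of_certificate hn (c := fun a => γ a + μ a) (y := fun p => r p - μ p.1)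
    (ζ := D ^ 2 - 2 * D * (1 + 2 * η)) (L := τ + η) (κ := 2 * D) ?_ ?_ ?_ (by positivity) ?_ hk
    (by linarith) ?_ h2
  · intro a
    simp [hsum, sum_sub_distrib, Nat.cast_smul_eq_nsmul]
  · intro a b hab
    have := hd a b hab
    nlinarith
  · intro a b i hab
    have hd' := hd a b hab
    set d := (γ a + μ a) - (γ b + μ b)
    have hy : ‖r (a, i) - μ a‖ ≤ 1 + η :=
      (norm_sub_le _ _).trans (add_le_add (hr _) (hmean a))
    have t1 := (abs_le.1 (abs_real_inner_le_norm d (r (a, i) - μ a))).1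
    have t2 : ‖d‖ * ‖r (a, i) - μ a‖ ≤ ‖d‖ * (1 + η) := by gcongr
    -- This product plus 2Dη is exactly the lower bound ‖d‖² - ζ - 2‖d‖(1 + η).
    have t3 : 0 ≤ (‖d‖ - D) * (‖d‖ + D - 2 * (1 + η)) :=
      mul_nonneg (by linarith) (by linarith)
    have t4 : 0 < D * η := mul_pos (by linarith) hη
    change 0 < ‖d‖ ^ 2 - (D ^ 2 - 2 * D * (1 + 2 * η)) + 2 * ⟪d, r (a, i) - μ a⟫
    nlinarith
  · intro a v
    refine le_trans ?_ (hmom a v)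
    -- Recentring at the empirical mean only decreases the second moment.
    have e : ∑ i, ⟪r (a, i) - μ a, v⟫ ^ 2 = ∑ i, ⟪r (a, i), v⟫ ^ 2 - n * ⟪μ a, v⟫ ^ 2 := by
      have t : ∑ i, ⟪r (a, i), v⟫ = n * ⟪μ a, v⟫ := by
        rw [← sum_inner, hsum, real_inner_smul_left]
      simp only [inner_sub_left, sub_sq, sum_add_distrib, sum_sub_distrib, ← sum_mul, ← mul_sum,
        t, sum_const, card_univ, Fintype.card_fin, nsmul_eq_mul]
      ring
    change ∑ i, ⟪r (a, i) - μ a, v⟫ ^ 2 ≤ _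
    rw [e]
    have : 0 ≤ n * ⟪μ a, v⟫ ^ 2 := by positivity
    linarith
  · intro a b hab
    have hd' := hd a b hab
    set d := (γ a + μ a) - (γ b + μ b)
    change 4 * ‖d‖ ^ 2 ≤ 2 * D * (‖d‖ ^ 2 - (D ^ 2 - 2 * D * (1 + 2 * η)))
    have t1 : D ^ 2 ≤ ‖d‖ ^ 2 := pow_le_pow_left₀ (by linarith) hd' 2
    have t2 : 0 ≤ (‖d‖ ^ 2 - D ^ 2) * (D - 2) := mul_nonneg (by linarith) (by linarith)
    have t3 : 0 ≤ D ^ 2 * η := by positivity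
    nlinarith

end Sample

/-! ### Elementary bounds on the separation and the condition number. -/

section Separation

variable {m k : ℕ} {γ : Fin k → EuclideanSpace ℝ (Fin m)}

lemma minSeparation_le {a b : Fin k} (hab : a ≠ b) : minSeparation γ ≤ ‖γ a - γ b‖ :=
  ciInf_le (f := fun p : {p : Fin k × Fin k // p.1 ≠ p.2} => ‖γ p.1.1 - γ p.1.2‖)
    (Set.finite_range _).bddBelow ⟨(a, b), hab⟩

lemma condNumber_nonneg : 0 ≤ condNumber γ :=
  div_nonneg (Real.iSup_nonneg fun _ => by positivity) (Real.iInf_nonneg fun _ => by positivity)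

lemma one_le_condNumber (hk : 2 ≤ k) (h : 0 < minSeparation γ) : 1 ≤ condNumber γ := by
  have p₀ : {p : Fin k × Fin k // p.1 ≠ p.2} :=
    ⟨(⟨0, by lia⟩, ⟨1, by lia⟩), by simp⟩
  have : Nonempty {p : Fin k × Fin k // p.1 ≠ p.2} := ⟨p₀⟩
  have hpos : 0 < ⨅ p : {p : Fin k × Fin k // p.1 ≠ p.2}, ‖γ p.1.1 - γ p.1.2‖ ^ 2 := by
    refine lt_of_lt_of_le (pow_pos h 2) (le_ciInf fun p => ?_)
    exact pow_le_pow_left₀ h.le (minSeparation_le p.2) 2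
  rw [condNumber, le_div_iff₀ hpos, one_mul]
  exact ciInf_le_ciSup (Set.finite_range _).bddBelow (Set.finite_range _).bddAbove

lemma minSeparation_eq_zero_of_dim_zero {γ : Fin k → EuclideanSpace ℝ (Fin 0)} :
    minSeparation γ = 0 := by
  simp [minSeparation, Subsingleton.elim (γ _ - γ _) 0]

end Separation

/-! ### Test functions for the concentration bound, and the conclusion. -/

/-- The coordinate functions and their pairwise products. -/
def coordMonomial {m : ℕ} : Fin m ⊕ Fin m × Fin m → EuclideanSpace ℝ (Fin m) → ℝ
  | .inl p, x => x p
  | .inr (p, q), x => x p * x q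

lemma measurable_coordMonomial {m : ℕ} (j : Fin m ⊕ Fin m × Fin m) :
    Measurable (coordMonomial j) := by
  rcases j with p | ⟨p, q⟩
  · change Measurable fun x : EuclideanSpace ℝ (Fin m) => x p
    fun_prop
  · change Measurable fun x : EuclideanSpace ℝ (Fin m) => x p * x q
    fun_prop

lemma abs_coordMonomial_le_one {m : ℕ} (j : Fin m ⊕ Fin m × Fin m)
    {x : EuclideanSpace ℝ (Fin m)} (hx : ‖x‖ ≤ 1) : |coordMonomial j x| ≤ 1 := by
  have h := fun p => (abs_coord_le_norm x p).trans hx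
  rcases j with p | ⟨p, q⟩
  · exact h p
  · change |x p * x q| ≤ 1
    rw [abs_mul]
    exact mul_le_one₀ (h p) (abs_nonneg _) (h q)

lemma recoversPlanted_of_moments {m k n : ℕ} (hn : 0 < n) (hk : 1 ≤ k)
    {𝒟 : Measure (EuclideanSpace ℝ (Fin m))} [IsProbabilityMeasure 𝒟]
    (hrot : RotationInvariant 𝒟) (hsupp : SupportedOnUnitBall 𝒟)
    {γ : Fin k → EuclideanSpace ℝ (Fin m)}
    {r : Fin k × Fin n → EuclideanSpace ℝ (Fin m)} {Δ ε : ℝ} (hε : 0 < m * ε)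
    (hΔ : ∀ a b, a ≠ b → Δ ≤ ‖γ a - γ b‖)
    (h1 : 2 * (1 + 2 * (m * ε)) < Δ - 2 * (m * ε))
    (h2 : (1 / m + m * ε) * (2 * k + (k - 1) * (2 * (Δ - 2 * (m * ε)))) ≤
        (Δ - 2 * (m * ε)) ^ 2 - 2 * (Δ - 2 * (m * ε)) * (1 + 2 * (m * ε)))
    (hr : ∀ p, ‖r p‖ ≤ 1)
    (hmom : ∀ a j, |∑ i, (coordMonomial j (r (a, i)) - ∫ x, coordMonomial j x ∂𝒟)| ≤ ε * n) :
    RecoversPlanted (fun p : Fin k × Fin n => r p + γ p.1) := by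
  have hn' : (0 : ℝ) < n := by positivity
  have hε' : 0 ≤ ε := (pos_of_mul_pos_right hε (by positivity)).le
  refine recoversPlanted_of_sample hn hk hε (τ := 1 / m) (by positivity) hΔ h1 h2 hr ?_ ?_
  · intro a
    refine norm_le_of_abs_coord_le fun p => ?_
    have h := hmom a (.inl p)
    simp only [coordMonomial, hrot.integral_coord p, sub_zero] at h
    have e : ((n : ℝ)⁻¹ • ∑ i, r (a, i)) p = (∑ i, r (a, i) p) / n := by
      simp [div_eq_inv_mul]
    rw [e, abs_div, abs_of_pos hn', div_le_iff₀ hn']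
    exact h
  · intro a v
    exact sum_inner_sq_le (M := fun p q => ∫ x, x p * x q ∂𝒟) hε'
      (fun p q hpq => hrot.integral_coord_mul_coord hpq)
      (fun p => hrot.integral_coord_sq_le hsupp p) (fun p q => hmom a (.inr (p, q))) v

end KMeansSDP

theorem mainTheorem1 {m k : ℕ} (hk : 2 ≤ k)
    (𝒟 : Measure (EuclideanSpace ℝ (Fin m))) [IsProbabilityMeasure 𝒟]
    (hrot : KMeansSDP.RotationInvariant 𝒟) (hsupp : KMeansSDP.SupportedOnUnitBall 𝒟)
    (γ : Fin k → EuclideanSpace ℝ (Fin m))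
    (hΔ : KMeansSDP.minSeparation γ > 2 + (k : ℝ) ^ 2 / (m : ℝ) * KMeansSDP.condNumber γ) :
    ∃ c : ℝ, 0 < c ∧ ∀ᶠ n : ℕ in atTop,
      KMeansSDP.stochasticBallModel 𝒟 γ n {x | ¬ KMeansSDP.RecoversPlanted x} ≤
        ENNReal.ofReal (Real.exp (-(c * (n : ℝ)))) := by
  open KMeansSDP in
  have hpos : 0 < minSeparation γ := by
    have : 0 ≤ (k : ℝ) ^ 2 / m * condNumber γ := mul_nonneg (by positivity) condNumber_nonneg
    linarith
  have hm : 0 < m := by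
    -- For m = 0 the quotient k²/m is 0 by convention, but all centres coincide, contradicting
    -- positive separation.
    rcases Nat.eq_zero_or_pos m with rfl | h
    · exact absurd minSeparation_eq_zero_of_dim_zero hpos.ne'
    · exact h
  have hm' : (0 : ℝ) < m := by positivity
  have hΔ' : 2 + (k : ℝ) ^ 2 / m < minSeparation γ := by
    have := le_mul_of_one_le_right (by positivity : 0 ≤ (k : ℝ) ^ 2 / m)
      (one_le_condNumber hk hpos)
    linarith
  obtain ⟨η, hη, h1, h2⟩ := exists_slack hk hm hΔ'
  -- A coordinatewise error ε becomes m·ε both for the mean and for the covariance.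
  obtain ⟨ε, rfl⟩ : ∃ ε, η = m * ε := ⟨η / m, by field_simp⟩
  have hε : 0 < ε := pos_of_mul_pos_right hη hm'.le
  obtain ⟨c, hc, hcn⟩ := exists_measure_exists_abs_sum_gt_le (k := k) 𝒟
    measurable_coordMonomial
    (fun j => hsupp.mono fun x hx => abs_coordMonomial_le_one j hx) hε
  refine ⟨c, hc, ?_⟩
  filter_upwards [hcn, eventually_gt_atTop 0] with n hbound hn
  refine le_trans ?_ hbound
  rw [stochasticBallModel]
  -- Translation is a measurable embedding, so the pushforward can be evaluated on the failure set
  -- without proving that set measurable.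
  have hemb : MeasurableEmbedding
      (fun (r : Fin k × Fin n → EuclideanSpace ℝ (Fin m)) p => r p + γ p.1) :=
    (MeasurableEquiv.addRight fun p : Fin k × Fin n => γ p.1).measurableEmbedding
  rw [hemb.map_apply]
  refine measure_mono_ae ?_
  have hae : ∀ᵐ r ∂(Measure.pi fun _ : Fin k × Fin n => 𝒟), ∀ p, ‖r p‖ ≤ 1 :=
    ae_all_iff.2 fun p => (measurePreserving_eval (fun _ : Fin k × Fin n => 𝒟) p).quasiMeasurePreserving.ae hsupp
  filter_upwards [hae] with r hr hfail
  by_contra hgood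
  refine hfail (recoversPlanted_of_moments hn (by lia) hrot hsupp hη
    (fun a b hab => minSeparation_le hab) h1 h2.le hr fun a j => ?_)
  by_contra hbad
  exact hgood ⟨a, j, not_le.1 hbad⟩
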